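/- Let $q$ be a prime power and let $\mathbb{F}_q$ be the finite field with $q$ elements. For subspaces $X,Y$ of $\mathbb{F}_q^n$ let $d_I(X,Y)=\max\{\dim X,\dim Y\}-\dim(X\cap Y)$ be their injection distance. Let $A_q(n,d,k)$ denote the maximum cardinality of a set $\mathbb{C}$ of $k$-dimensional subspaces of $\mathbb{F}_q^n$ whose minimum injection distance $\min\{d_I(X,Y) : X,Y\in\mathbb{C},\ X\neq Y\}$ equals $d$, and let $\left[{m \atop r}\right]_q=\prod_{i=0}^{r-1}\frac{q^{m-i}-1}{q^{r-i}-1}$ be the $q$-ary Gaussian coefficient. Let $k\geq 3$ and $n\geq \frac{k^2+3k-2}{2}$ be integers. Put $\ell=n-\frac{k^2+k-6}{2}$ if $n-\frac{k^2+k-6}{2}$ is odd, and $\ell=n-\frac{k^2+k-4}{2}$ if $n-\frac{k^2+k-6}{2}$ is even, and assume that $q^2+q+1\geq \ell$. Then \[ A_q(n,k-1,k)\;\geq\; q^{2(n-k)}+\sum_{j=3}^{k-1} q^{2\left(n-\sum_{i=j}^{k} i\right)}+\left[{n-\frac{k^2+k-6}{2} \atop 2}\right]_q . \] -/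

import Mathlib

namespace SubspaceCode

/-- The set of all `k`-dimensional subspaces of `F ^ n`. -/
def grassmannian (F : Type*) [Field F] (k n : ℕ) : Set (Submodule F (Fin n → F)) :=
  {X | Module.finrank F X = k}

/-- The injection distance `max {dim X, dim Y} - dim (X ∩ Y)`. The subtraction never truncates. -/
noncomputable def injectionDist {F : Type*} [Field F] {n : ℕ}
    (X Y : Submodule F (Fin n → F)) : ℕ :=
  max (Module.finrank F X) (Module.finrank F Y) - Module.finrank F (X ⊓ Y : Submodule F (Fin n → F))

/-- `C` is an `(n, M, d, k)` constant-dimension code over `F`: it consists of `M` subspaces of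
`F ^ n` of dimension `k`, and the minimum injection distance between distinct codewords
exists and equals `d`. -/
structure IsConstantDimCode (F : Type*) [Field F] (n M d k : ℕ)
    (C : Set (Submodule F (Fin n → F))) : Prop where
  subset_grassmannian : C ⊆ grassmannian F k n
  finite : C.Finite
  ncard_eq : C.ncard = M
  isLeast_dist : IsLeast {δ | ∃ X ∈ C, ∃ Y ∈ C, X ≠ Y ∧ δ = injectionDist X Y} d

/-- `A_q(n, d, k)` for `q = |F|`: the maximum size `M` of an `(n, M, d, k)` code over `F`. -/
noncomputable def maxCodeSize (F : Type*) [Field F] (n d k : ℕ) : ℕ :=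
  sSup {M | ∃ C : Set (Submodule F (Fin n → F)), IsConstantDimCode F n M d k C}

/-- Over a finite field, the supremum defining `maxCodeSize` is a maximum as soon as there is
some code with the given parameters. -/
theorem isGreatest_maxCodeSize (F : Type*) [Field F] [Finite F] {n M d k : ℕ}
    {C : Set (Submodule F (Fin n → F))} (hC : IsConstantDimCode F n M d k C) :
    IsGreatest {M | ∃ C : Set (Submodule F (Fin n → F)), IsConstantDimCode F n M d k C}
      (maxCodeSize F n d k) := by
  have hb : BddAbove
      {M | ∃ C : Set (Submodule F (Fin n → F)), IsConstantDimCode F n M d k C} := by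
    refine ⟨Nat.card (Submodule F (Fin n → F)), ?_⟩
    rintro M ⟨D, hD⟩
    rw [← hD.ncard_eq, ← Set.ncard_univ]
    exact Set.ncard_le_ncard (Set.subset_univ D) Set.finite_univ
  exact ⟨Nat.sSup_mem ⟨M, C, hC⟩ hb, fun N hN => le_csSup hb hN⟩

/-- The `q`-ary Gaussian coefficient `∏ i < k, (q ^ (n - i) - 1) / (q ^ (k - i) - 1)`
(meant for `k ≤ n` and `2 ≤ q`). -/
def gaussianCoeff (q n k : ℕ) : ℚ :=
  ∏ i ∈ Finset.range k, ((q : ℚ) ^ (n - i) - 1) / ((q : ℚ) ^ (k - i) - 1)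

end SubspaceCode

/-!
The code is built in a coordinate space made of blocks of lengths `k, k - 1, …, 3` followed by a
tail of length `N = n - (3 + ⋯ + k)`; the hypothesis on `n` says `N ≥ k + 2`. Two codewords have to
meet in at most a line.

*Lifting.* Fix a skeleton: a parametrization of a `k`-space which is injective on a set `A` of
coordinates. Filling the coordinates off `A` with the members of a Gabidulin code, that is with the
maps `x ↦ a x + b x ^ q`, where `F ^ k` is embedded into the extension of degree `m = |Aᶜ| ≥ k`,
yields `q ^ (2 m)` spaces, and two of them meet in the image of the kernel of a nonzero
`x ↦ a x + b x ^ q`, which is at most a line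
(`exists_linearMap_finrank_ker_le_one`, `exists_lifted_code`).

*Levels.* For each block, of length `j` say, the level skeleton has an identity matrix in this
block and a unit vector in each longer block. It contributes `q ^ (2 (n - (j + ⋯ + k)))` codewords:
the powers of `q` in the bound.

*Planes.* Each plane `W` of the tail space contributes one codeword, which accounts for the Gaussian
coefficient. It contains `W` and has one further row for every block. The two pivots of `W` form an
edge of the complete graph on the tail coordinates. Colour the edges properly with `ℓ` colours
(`exists_edge_coloring`), which is possible because `ℓ` is odd and `N ≤ ℓ + 1`, and assign distinct
points of the projective plane to the colours; this is where `ℓ ≤ q ^ 2 + q + 1` enters. The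
row of each block carries, in that block, the point of the colour of `W`. Then two codewords with
different colours meet inside the intersection of their planes
(`IsOverPlane.finrank_inf_le_one_of_ne`). Distinct edges of one colour are disjoint, so the planes
meet trivially; there are at most `N / 2 ≤ q ^ 2` edges of one colour, so they can be labelled
injectively by the cosets of the point in `F ^ 3`, and adding the label of the edge in the
next shorter block confines the intersection to a line
(`IsOverPlane.finrank_inf_le_one_of_disjoint`). Planes with the same pivots
share a skeleton, and the Gabidulin filling can be chosen to realize any reduced basis
(`exists_codewords_over_edge`).

The unit vectors used by the levels avoid the first three positions of a block, where the points of
the projective plane live, and different levels use different ones; hence codewords of different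
levels, or of a level and a plane, also meet in at most a line.
-/

namespace SubspaceCode

open Module

/-! ### Codes, rank-metric codes and counting planes -/

/-- A family of `k`-spaces meeting pairwise in at most a line, with equality at least once, is a
code of minimum injection distance exactly `k - 1`. -/
theorem card_le_maxCodeSize {F : Type*} [Field F] [Finite F] {E : Type*} [AddCommGroup E]
    [Module F E] [FiniteDimensional F E] {n k : ℕ} (hn : finrank F E = n) (hk : 2 ≤ k)
    {ι : Type*} [Finite ι] (X : ι → Submodule F E) (hX : ∀ i, finrank F (X i) = k)
    (hXX : ∀ i j, i ≠ j → finrank F (X i ⊓ X j : Submodule F E) ≤ 1)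
    {i₀ j₀ : ι} (hij : i₀ ≠ j₀) (h₀ : 1 ≤ finrank F (X i₀ ⊓ X j₀ : Submodule F E)) :
    Nat.card ι ≤ maxCodeSize F n (k - 1) k := by
  have e : E ≃ₗ[F] (Fin n → F) := LinearEquiv.ofFinrankEq _ _ (by simp [hn])
  let Y : ι → Submodule F (Fin n → F) := fun i => (X i).map (e : E →ₗ[F] (Fin n → F))
  have hY : ∀ i, finrank F (Y i) = k := fun i => (LinearEquiv.finrank_map_eq e _).trans (hX i)
  have hYY : ∀ i j, finrank F (Y i ⊓ Y j : Submodule F (Fin n → F))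
      = finrank F (X i ⊓ X j : Submodule F E) := fun i j => by
    rw [← Submodule.map_inf _ e.injective]
    exact LinearEquiv.finrank_map_eq e _
  have hdist : ∀ i j, injectionDist (Y i) (Y j)
      = k - finrank F (X i ⊓ X j : Submodule F E) := fun i j => by
    simp [injectionDist, hY, hYY]
  have hinj : Function.Injective Y := by
    intro i j h
    by_contra hne
    have h1 := hXX i j hne
    rw [← hYY, ← h, inf_idem, hY] at h1
    omega
  have hC : IsConstantDimCode F n (Nat.card ι) (k - 1) k (Set.range Y) := by
    refine ⟨?_, Set.finite_range Y, ?_, ?_, ?_⟩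
    · rintro _ ⟨i, rfl⟩
      exact hY i
    · rw [← Set.image_univ, Set.ncard_image_of_injective _ hinj, Set.ncard_univ]
    · refine ⟨Y i₀, ⟨i₀, rfl⟩, Y j₀, ⟨j₀, rfl⟩, hinj.ne hij, ?_⟩
      rw [hdist, le_antisymm (hXX _ _ hij) h₀]
    · rintro _ ⟨_, ⟨i, rfl⟩, _, ⟨j, rfl⟩, hne, rfl⟩
      have := hXX i j (fun h => hne (h ▸ rfl))
      rw [hdist]
      omega
  exact (isGreatest_maxCodeSize F hC).2 ⟨_, hC⟩

/-- Two images `range f` and `range g` meet in at most a line as soon as one linear functional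
separates the solutions of `f x = g y`. -/
theorem finrank_range_inf_range_le_one {F : Type*} [Field F] {U V E : Type*}
    [AddCommGroup U] [Module F U] [FiniteDimensional F U]
    [AddCommGroup V] [Module F V] [FiniteDimensional F V] [AddCommGroup E] [Module F E]
    (f : U →ₗ[F] E) (g : V →ₗ[F] E) (l : U × V →ₗ[F] F)
    (h : ∀ x y, f x = g y → l (x, y) = 0 → f x = 0) :
    finrank F (LinearMap.range f ⊓ LinearMap.range g : Submodule F E) ≤ 1 := by
  by_cases h0 : LinearMap.range f ⊓ LinearMap.range g = ⊥
  · rw [h0]; simp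
  obtain ⟨v, hv, hv0⟩ := Submodule.exists_mem_ne_zero_of_ne_bot h0
  obtain ⟨⟨x, hx⟩, y, hy⟩ := id hv
  have hl : l (x, y) ≠ 0 := fun hl => hv0 (hx ▸ h x y (hx.trans hy.symm) hl)
  refine finrank_le_one (⟨v, hv⟩ : (LinearMap.range f ⊓ LinearMap.range g : Submodule F E)) ?_
  rintro ⟨w, ⟨x', hx'⟩, y', hy'⟩
  refine ⟨l (x', y') / l (x, y), Subtype.ext ?_⟩
  have key := h (x' - (l (x', y') / l (x, y)) • x) (y' - (l (x', y') / l (x, y)) • y)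
    (by simp [hx, hx', hy, hy']) (by
      have : ((x' - (l (x', y') / l (x, y)) • x, y' - (l (x', y') / l (x, y)) • y) : U × V)
        = (x', y') - (l (x', y') / l (x, y)) • (x, y) := rfl
      rw [this, map_sub, map_smul, smul_eq_mul, div_mul_cancel₀ _ hl, sub_self])
  rw [map_sub, map_smul, hx, hx', sub_eq_zero] at key
  exact key.symm

/-- A linear space of rank-metric codewords in the manner of Delsarte and Gabidulin: a
`2 * dim T`-dimensional space of linear maps `U → T` whose nonzero members have rank at least
`dim U - 1`. -/
theorem exists_linearMap_finrank_ker_le_one (F : Type*) [Field F] [Finite F] (U T : Type*)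
    [AddCommGroup U] [Module F U] [FiniteDimensional F U] [AddCommGroup T] [Module F T]
    [FiniteDimensional F T] (hT : finrank F T ≠ 0) (hUT : finrank F U ≤ finrank F T) :
    ∃ M : (T × T) →ₗ[F] U →ₗ[F] T, ∀ z ≠ 0, finrank F (LinearMap.ker (M z)) ≤ 1 := by
  obtain ⟨p, hp⟩ := CharP.exists F
  have : Fact p.Prime := ⟨CharP.char_is_prime F p⟩
  have : NeZero (finrank F T) := ⟨hT⟩
  let K := FiniteField.Extension F p (finrank F T)
  have hK : finrank F K = finrank F T := FiniteField.finrank_extension F p _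
  let e : T ≃ₗ[F] K := LinearEquiv.ofFinrankEq _ _ hK.symm
  obtain ⟨φ, hφ⟩ := finrank_le_iff_exists_linearMap.mp (hUT.trans hK.ge)
  let τ := FiniteField.Extension.frob F p (finrank F T)
  have hfix : ∀ u : K, τ u = u → ∃ c : F, algebraMap F K c = u := by
    intro u hu
    have hu' : ∀ i : ℕ, (τ ^ i) u = u := by
      intro i
      induction i with
      | zero => rfl
      | succ i ih => rw [pow_succ, AlgEquiv.mul_apply, hu, ih]
    have : u ∈ (⊥ : IntermediateField F K) := by
      rw [IsGalois.mem_bot_iff_fixed]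
      intro g
      obtain ⟨i, -, rfl⟩ := FiniteField.Extension.exists_frob_pow_eq F p _ g
      exact hu' i
    exact IntermediateField.mem_bot.mp this
  let M : (T × T) →ₗ[F] U →ₗ[F] T := LinearMap.mk₂ F
    (fun z x => e.symm (e z.1 * φ x + e z.2 * τ (φ x)))
    (by intros; simp only [← map_add]; congr 1; simp; ring)
    (by intros; simp only [← map_smul]; congr 1; simp)
    (by intros; simp only [← map_add]; congr 1; simp; ring)
    (by intros; simp only [← map_smul]; congr 1; simp)
  refine ⟨M, fun z hz => ?_⟩
  have hker : ∀ x, M z x = 0 ↔ e z.1 * φ x + e z.2 * τ (φ x) = 0 := fun x =>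
    e.symm.map_eq_zero_iff
  by_cases h0 : LinearMap.ker (M z) = ⊥
  · rw [h0]; simp
  obtain ⟨v, hv, hv0⟩ := Submodule.exists_mem_ne_zero_of_ne_bot h0
  have hφv : φ v ≠ 0 := fun h => hv0 (hφ (by rw [h, map_zero]))
  have hτv : τ (φ v) ≠ 0 := by simpa using hφv
  have hv' := (hker v).mp hv
  have hz2 : e z.2 ≠ 0 := by
    intro h2
    rw [h2, zero_mul, add_zero] at hv'
    have h1 := (mul_eq_zero.mp hv').resolve_right hφv
    exact hz (Prod.ext (by simpa using h1) (by simpa using h2))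
  refine finrank_le_one (⟨v, hv⟩ : LinearMap.ker (M z)) ?_
  rintro ⟨w, hw⟩
  have hw' := (hker w).mp hw
  -- Both `φ v` and `φ w` are roots of `a u + b u ^ q`, so their ratio is fixed by Frobenius.
  have hr : τ (φ w / φ v) = φ w / φ v := by
    rw [map_div₀, div_eq_div_iff hτv hφv]
    apply mul_left_cancel₀ hz2
    linear_combination φ v * hw' - φ w * hv'
  obtain ⟨c, hc⟩ := hfix _ hr
  refine ⟨c, Subtype.ext (hφ ?_)⟩
  change φ (c • v) = φ w
  rw [map_smul, Algebra.smul_def, hc, div_mul_cancel₀ _ hφv]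

/-- Count of the two-dimensional subspaces, by counting their ordered bases. -/
theorem card_finrank_eq_two {F : Type*} [Field F] [Fintype F] {V : Type*} [AddCommGroup V]
    [Module F V] [FiniteDimensional F V] (hV : 2 ≤ finrank F V) :
    (Nat.card {W : Submodule F V // finrank F W = 2} : ℚ)
      = gaussianCoeff (Fintype.card F) (finrank F V) 2 := by
  have : Finite V := Module.finite_of_finite F
  have : Fintype {W : Submodule F V // finrank F W = 2} := Fintype.ofFinite _
  let f : (Σ W : {W : Submodule F V // finrank F W = 2},
      {s : Fin 2 → W.1 // LinearIndependent F s}) → {s : Fin 2 → V // LinearIndependent F s} :=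
    fun s => ⟨fun i => (s.2.1 i : V), s.2.2.map' (Submodule.subtype _) (by simp)⟩
  have hspan : ∀ s, Submodule.span F (Set.range (f s).1) = s.1.1 := by
    rintro ⟨⟨W, hW⟩, s⟩
    apply Submodule.eq_of_le_of_finrank_eq
    · rw [Submodule.span_le]
      rintro _ ⟨i, rfl⟩
      exact (s.1 i).2
    · rw [finrank_span_eq_card (f _).2, hW]; rfl
  have hf : Function.Bijective f := by
    constructor
    · rintro s t h
      have hst : s.1 = t.1 := Subtype.ext (by rw [← hspan, ← hspan, h])
      obtain ⟨W, s⟩ := s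
      obtain ⟨W', t⟩ := t
      obtain rfl : W = W' := hst
      congr 1
      ext i
      exact congrFun (congrArg Subtype.val h) i
    · intro s
      exact ⟨⟨⟨Submodule.span F (Set.range s.1), by rw [finrank_span_eq_card s.2]; rfl⟩,
        ⟨fun i => ⟨s.1 i, Submodule.subset_span ⟨i, rfl⟩⟩,
          LinearIndependent.of_comp (Submodule.subtype _) s.2⟩⟩, rfl⟩
  have h1 := (Nat.card_congr (Equiv.ofBijective f hf)).symm
  rw [card_linearIndependent hV, Nat.card_sigma] at h1
  have h2 : ∀ W : {W : Submodule F V // finrank F W = 2},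
      Nat.card {s : Fin 2 → W.1 // LinearIndependent F s}
        = ∏ i : Fin 2, (Fintype.card F ^ 2 - Fintype.card F ^ i.val) := fun W => by
    rw [card_linearIndependent W.2.ge, W.2]
  simp only [h2, Finset.sum_const, Finset.card_univ, ← Nat.card_eq_fintype_card,
    Fin.prod_univ_two, smul_eq_mul, Fin.val_zero, Fin.val_one] at h1
  simp only [Nat.card_eq_fintype_card (α := F)] at h1
  set q := Fintype.card F
  have hq : 1 < q := Fintype.one_lt_card
  obtain ⟨m, hm⟩ := Nat.exists_eq_add_of_le hV
  rw [hm] at h1 ⊢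
  have hq1 : (1 : ℚ) < q := by exact_mod_cast hq
  have h3 := congrArg (Nat.cast : ℕ → ℚ) h1
  push_cast [Nat.cast_sub (Nat.pow_le_pow_right hq.le (by omega : 0 ≤ 2 + m)),
    Nat.cast_sub (Nat.pow_le_pow_right hq.le (by omega : 1 ≤ 2 + m)),
    Nat.cast_sub (Nat.pow_le_pow_right hq.le (by omega : 0 ≤ 2)),
    Nat.cast_sub (Nat.pow_le_pow_right hq.le (by omega : 1 ≤ 2))] at h3
  have e1 : (q : ℚ) ^ 2 - 1 ≠ 0 := by nlinarith
  have e2 : (q : ℚ) - 1 ≠ 0 := by linarith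
  have e3 : (q : ℚ) ≠ 0 := by linarith
  have e4 : 2 + m - 1 = m + 1 := by omega
  simp only [gaussianCoeff, Finset.prod_range_succ, Finset.prod_range_zero, one_mul, e4,
    Nat.sub_zero, Nat.add_one_sub_one, pow_one]
  norm_num
  rw [div_mul_div_comm, eq_div_iff (mul_ne_zero e1 e2)]
  apply mul_left_cancel₀ e3
  simp only [pow_zero, pow_one] at h3
  have e5 : (q : ℚ) ^ (2 + m) = q * q ^ (m + 1) := by ring
  rw [e5] at h3 ⊢
  rw [Nat.card_eq_fintype_card] at h3
  linear_combination -h3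

/-! ### Reduced bases, edge colourings and the projective plane -/

/-- The reduced row echelon basis of a plane in `F ^ N`, with pivots `i < j`. The last clause says
that every nonzero vector of the plane has its leading entry in a pivot column. -/
theorem exists_reduced_basis {F : Type*} [Field F] {N : ℕ} (W : Submodule F (Fin N → F))
    (hW : finrank F W = 2) :
    ∃ (e : Fin N × Fin N) (w : (Fin N → F) × (Fin N → F)), e.1 < e.2 ∧ w.1 ∈ W ∧ w.2 ∈ W ∧
      w.1 e.1 = 1 ∧ w.1 e.2 = 0 ∧ w.2 e.1 = 0 ∧ w.2 e.2 = 1 ∧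
      (∀ v ∈ W, v = v e.1 • w.1 + v e.2 • w.2) ∧
      ∀ v ∈ W, v ≠ 0 → ∃ t, (t = e.1 ∨ t = e.2) ∧ v t ≠ 0 ∧ ∀ s < t, v s = 0 := by
  classical
  have hmin : ∀ U : Submodule F (Fin N → F), U ≠ ⊥ →
      ∃ i, (∃ u ∈ U, u i = 1) ∧ ∀ s < i, ∀ u ∈ U, u s = 0 := by
    intro U hU
    obtain ⟨u, hu, hu0⟩ := Submodule.exists_mem_ne_zero_of_ne_bot hU
    obtain ⟨s, hs⟩ := Function.ne_iff.mp hu0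
    let S := Finset.univ.filter fun i => ∃ u ∈ U, u i ≠ 0
    have hS : S.Nonempty := ⟨s, by simpa [S] using ⟨u, hu, hs⟩⟩
    obtain ⟨v, hv, hvi⟩ := (Finset.mem_filter.mp (S.min'_mem hS)).2
    refine ⟨S.min' hS, ⟨(v (S.min' hS))⁻¹ • v, U.smul_mem _ hv, by simp [hvi]⟩, ?_⟩
    intro t ht x hx
    by_contra h
    exact absurd (S.min'_le t (by simpa [S] using ⟨x, hx, h⟩)) (not_le.mpr ht)
  obtain ⟨i, ⟨a, ha, hai⟩, hi⟩ := hmin W (by rintro rfl; simp at hW)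
  let H := W ⊓ LinearMap.ker (LinearMap.proj i : (Fin N → F) →ₗ[F] F)
  have hH : H ≠ ⊥ := by
    intro h
    have hinj : Function.Injective ((LinearMap.proj i : (Fin N → F) →ₗ[F] F).domRestrict W) := by
      rw [← LinearMap.ker_eq_bot, LinearMap.ker_eq_bot']
      rintro ⟨w, hw⟩ h0
      have : w ∈ H := ⟨hw, h0⟩
      rw [h, Submodule.mem_bot] at this
      exact Subtype.ext this
    have := LinearMap.finrank_le_finrank_of_injective hinj
    rw [hW, finrank_self] at this
    omega
  obtain ⟨j, ⟨b, hb, hbj⟩, hj⟩ := hmin H hH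
  have hbi : b i = 0 := hb.2
  have hij : i < j := by
    rcases lt_trichotomy i j with h | h | h
    · exact h
    · rw [← h, hbi] at hbj
      exact absurd hbj zero_ne_one
    · rw [hi j h b hb.1] at hbj
      exact absurd hbj zero_ne_one
  have ha' : a - a j • b ∈ W := W.sub_mem ha (W.smul_mem _ hb.1)
  have hspan : ∀ v ∈ W, v i = 0 → v j = 0 → v = 0 := by
    let g : W →ₗ[F] (Fin 2 → F) :=
      (LinearMap.pi ![LinearMap.proj i, LinearMap.proj j]).domRestrict W
    have hg : Function.Surjective g := by
      intro c
      refine ⟨⟨c 0 • (a - a j • b) + c 1 • b, W.add_mem (W.smul_mem _ ha')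
        (W.smul_mem _ hb.1)⟩, ?_⟩
      ext t
      fin_cases t <;> simp [g, hai, hbi, hbj]
    have hfr : finrank F W = finrank F (Fin 2 → F) := by simp [hW]
    have : FiniteDimensional F W := inferInstance
    have hg' := (LinearMap.injective_iff_surjective_of_finrank_eq_finrank hfr).mpr hg
    intro v hv h1 h2
    have : g ⟨v, hv⟩ = g 0 := by
      ext t
      fin_cases t <;> simp [g, h1, h2]
    exact congrArg Subtype.val (hg' this)
  have hexp : ∀ v ∈ W, v = v i • (a - a j • b) + v j • b := by
    intro v hv
    rw [← sub_eq_zero]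
    refine hspan _ (W.sub_mem hv (W.add_mem (W.smul_mem _ ha') (W.smul_mem _ hb.1))) ?_ ?_
      <;> simp [hai, hbi, hbj]
  refine ⟨(i, j), (a - a j • b, b), hij, ha', hb.1, by simp [hai, hbi], by simp [hbj], hbi, hbj,
    hexp, ?_⟩
  intro v hv hv0
  by_cases hvi : v i = 0
  · refine ⟨j, Or.inr rfl, fun hvj => hv0 (hspan v hv hvi hvj), fun s hs => hj s hs v ⟨hv, hvi⟩⟩
  · exact ⟨i, Or.inl rfl, hvi, fun s hs => hi s hs v hv⟩

/-- Edges `i < j` of the complete graph on `Fin N`. -/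
abbrev Edge (N : ℕ) := {e : Fin N × Fin N // e.1 < e.2}

/-- Two edges with a common endpoint. -/
def Edge.Meets {N : ℕ} (e f : Edge N) : Prop :=
  e.1.1 = f.1.1 ∨ e.1.1 = f.1.2 ∨ e.1.2 = f.1.1 ∨ e.1.2 = f.1.2

/-- The classical one-factorization: for odd `ℓ`, the complete graph on `ZMod ℓ` and one further
vertex, labelled `ℓ`, has a proper edge colouring with `ℓ` colours. -/
theorem exists_edge_coloring {N ℓ : ℕ} (hℓ : Odd ℓ) (hN : N ≤ ℓ + 1) :
    ∃ c : Edge N → Fin ℓ, ∀ e f, e ≠ f → e.Meets f → c e ≠ c f := by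
  have : NeZero ℓ := ⟨hℓ.pos.ne'⟩
  have hcast : ∀ a b : ℕ, a < ℓ → b < ℓ → (a : ZMod ℓ) = b → a = b := by
    intro a b ha hb h
    rw [ZMod.natCast_eq_natCast_iff] at h
    exact Nat.ModEq.eq_of_lt_of_lt h ha hb
  have hdouble : ∀ a b : ZMod ℓ, a + a = b + b → a = b := by
    intro a b h
    have h2 : IsUnit (2 : ZMod ℓ) := by
      have := (ZMod.isUnit_iff_coprime 2 ℓ).mpr hℓ.coprime_two_left
      simpa using this
    apply h2.mul_left_cancel
    rw [two_mul, two_mul, h]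
  let c : Edge N → ZMod ℓ := fun e =>
    (e.1.1 : ℕ) + if (e.1.2 : ℕ) = ℓ then ((e.1.1 : ℕ) : ZMod ℓ) else (e.1.2 : ℕ)
  obtain ⟨φ⟩ : Nonempty (ZMod ℓ ≃ Fin ℓ) := by
    exact Fintype.card_eq.mp (by simp [ZMod.card])
  refine ⟨fun e => φ (c e), ?_⟩
  rintro ⟨⟨i, j⟩, hij⟩ ⟨⟨i', j'⟩, hij'⟩ hne hm h
  have h := φ.injective h
  have hi : (i : ℕ) < ℓ := by have := j.2; have : (i : ℕ) < j := hij; omega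
  have hi' : (i' : ℕ) < ℓ := by have := j'.2; have : (i' : ℕ) < j' := hij'; omega
  have hijn : (i : ℕ) < j := hij
  have hijn' : (i' : ℕ) < j' := hij'
  have hjN := j.2
  have hjN' := j'.2
  have hne' : ¬((i : ℕ) = i' ∧ (j : ℕ) = j') := by
    rintro ⟨h1, h2⟩
    exact hne (Subtype.ext (Prod.ext (Fin.ext h1) (Fin.ext h2)))
  have hm' : (i : ℕ) = i' ∨ (i : ℕ) = j' ∨ (j : ℕ) = i' ∨ (j : ℕ) = j' := by
    simpa [Edge.Meets, Fin.ext_iff] using hm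
  simp only [c] at h
  generalize (i : ℕ) = a at *
  generalize (j : ℕ) = b at *
  generalize (i' : ℕ) = a' at *
  generalize (j' : ℕ) = b' at *
  split_ifs at h with h1 h2 h2
  · have := hcast _ _ hi hi' (hdouble _ _ h)
    omega
  · rcases hm' with rfl | rfl | rfl | rfl
    · have := hcast _ _ hi (by omega) (add_left_cancel h)
      omega
    · rw [add_comm (a' : ZMod ℓ)] at h
      have := hcast _ _ hi (by omega) (add_left_cancel h)
      omega
    · omega
    · omega
  · rcases hm' with rfl | rfl | rfl | rfl
    · have := hcast _ _ (by omega) hi (add_left_cancel h)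
      omega
    · omega
    · rw [add_comm (a : ZMod ℓ)] at h
      have := hcast _ _ hi hi' (add_left_cancel h)
      omega
    · omega
  · rcases hm' with rfl | rfl | rfl | rfl
    · have := hcast _ _ (by omega) (by omega) (add_left_cancel h)
      omega
    · rw [add_comm (a' : ZMod ℓ)] at h
      have := hcast _ _ (by omega) (by omega) (add_left_cancel h)
      omega
    · rw [add_comm (a : ZMod ℓ)] at h
      have := hcast _ _ (by omega) (by omega) (add_left_cancel h)
      omega
    · have := hcast _ _ (by omega) (by omega) (add_right_cancel h)
      omega

/-- A colour class of a proper edge colouring is a matching, hence has at most `N / 2` edges and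
can be labelled injectively by any set with that many elements. -/
theorem exists_label_injOn_colors {N : ℕ} {α β : Type*} [Finite β] (c : Edge N → α)
    (hc : ∀ e f, e ≠ f → e.Meets f → c e ≠ c f) (hβ : N ≤ 2 * Nat.card β) :
    ∃ s : Edge N → β, ∀ e f, c e = c f → s e = s f → e = f := by
  classical
  have := Fintype.ofFinite β
  have key : ∀ χ : α, Nonempty ({e // c e = χ} ↪ β) := by
    intro χ
    rw [Function.Embedding.nonempty_iff_card_le]
    let g : {e // c e = χ} × Bool → Fin N := fun x => if x.2 then x.1.1.1.1 else x.1.1.1.2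
    have hg : Function.Injective g := by
      rintro ⟨⟨e, he⟩, a⟩ ⟨⟨f, hf⟩, b⟩ h
      have hef : e = f := by
        by_contra hne
        refine hc e f hne ?_ (he.trans hf.symm)
        cases a <;> cases b <;> simp [g] at h <;> simp [Edge.Meets, h]
      subst hef
      have := e.2
      cases a <;> cases b <;> simp [g] at h ⊢
      · exact absurd h this.ne'
      · exact absurd h this.ne
    have := Fintype.card_le_of_injective g hg
    rw [Fintype.card_prod, Fintype.card_bool, Fintype.card_fin] at this
    rw [Nat.card_eq_fintype_card] at hβ
    omega
  let φ := fun χ => (key χ).some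
  refine ⟨fun e => φ (c e) ⟨e, rfl⟩, ?_⟩
  intro e f h1 h2
  have : ∀ χ (h : c f = χ), φ χ ⟨f, h⟩ = φ (c f) ⟨f, rfl⟩ := by rintro _ rfl; rfl
  have h3 : φ (c e) ⟨e, rfl⟩ = φ (c e) ⟨f, h1.symm⟩ := h2.trans (this _ _).symm
  exact congrArg Subtype.val ((φ (c e)).injective h3)

/-- Index set of the `q ^ 2 + q + 1` points of the projective plane over `F`. -/
abbrev PlanePoint (F : Type*) := (F × F) ⊕ F ⊕ Unit

/-- Normalized homogeneous coordinates of a point of the projective plane, as a sequence supported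
on `{0, 1, 2}`. -/
def planePoint {F : Type*} [Field F] : PlanePoint F → ℕ → F
  | .inl (a, _), 1 => a
  | .inl (_, b), 2 => b
  | .inl _, 0 => 1
  | .inr (.inl a), 2 => a
  | .inr (.inl _), 1 => 1
  | .inr (.inr _), 2 => 1
  | _, _ => 0

/-- Representatives of the `q ^ 2` cosets of the line spanned by `planePoint P` in `F ^ 3`, as
sequences supported on `{0, 1, 2}`. -/
def planeCoset {F : Type*} [Field F] : PlanePoint F → F × F → ℕ → F
  | .inl _, (u, _), 1 => u
  | .inl _, (_, v), 2 => v
  | .inr (.inl _), (u, _), 0 => u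
  | .inr (.inl _), (_, v), 2 => v
  | .inr (.inr _), (u, _), 0 => u
  | .inr (.inr _), (_, v), 1 => v
  | _, _, _ => 0

theorem eq_zero_of_mul_planePoint_eq_zero {F : Type*} [Field F] {P : PlanePoint F} {x : F}
    (h : ∀ i < 3, x * planePoint P i = 0) : x = 0 := by
  have h0 := h 0 (by norm_num)
  have h1 := h 1 (by norm_num)
  have h2 := h 2 (by norm_num)
  rcases P with ⟨a, b⟩ | a | a <;> simp [planePoint] at h0 h1 h2 <;> assumption

theorem eq_zero_of_mul_planePoint_eq {F : Type*} [Field F] {P Q : PlanePoint F} (hPQ : P ≠ Q)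
    {x y : F} (h : ∀ i < 3, x * planePoint P i = y * planePoint Q i) : x = 0 ∧ y = 0 := by
  have h0 := h 0 (by norm_num)
  have h1 := h 1 (by norm_num)
  have h2 := h 2 (by norm_num)
  rcases P with ⟨a, b⟩ | a | a <;> rcases Q with ⟨a', b'⟩ | a' | a' <;>
    clear h <;> simp [planePoint] at h0 h1 h2 <;> grind

theorem eq_zero_of_mul_planePoint_add_eq {F : Type*} [Field F] {P : PlanePoint F} {s t : F × F}
    (hst : s ≠ t) {x y z : F}
    (h : ∀ i < 3, x * planePoint P i + z * planeCoset P s i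
      = y * planePoint P i + z * planeCoset P t i) : x = y ∧ z = 0 := by
  have h0 := h 0 (by norm_num)
  have h1 := h 1 (by norm_num)
  have h2 := h 2 (by norm_num)
  obtain ⟨u, v⟩ := s
  obtain ⟨u', v'⟩ := t
  rcases P with ⟨a, b⟩ | a | a <;>
    clear h <;> simp only [planePoint, planeCoset] at h0 h1 h2 <;> grind

theorem card_planePoint (F : Type*) [Fintype F] :
    Fintype.card (PlanePoint F) = Fintype.card F ^ 2 + Fintype.card F + 1 := by
  simp [sq, add_assoc]

/-! ### Skeletons and lifted codes -/

/-- Extension by zero of vectors supported off `A`. -/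
noncomputable def extendOff (F : Type*) [Field F] {ι : Type*} (A : Set ι) :
    ({c // c ∉ A} → F) →ₗ[F] (ι → F) :=
  Function.ExtendByZero.linearMap F Subtype.val

theorem extendOff_of_mem {F : Type*} [Field F] {ι : Type*} {A : Set ι} (t : {c // c ∉ A} → F)
    {c : ι} (hc : c ∈ A) : extendOff F A t c = 0 := by
  change Function.extend Subtype.val t 0 c = 0
  rw [Function.extend_apply']
  · rfl
  · rintro ⟨a, rfl⟩
    exact a.2 hc

theorem extendOff_of_notMem {F : Type*} [Field F] {ι : Type*} {A : Set ι}
    (t : {c // c ∉ A} → F) {c : ι} (hc : c ∉ A) : extendOff F A t c = t ⟨c, hc⟩ :=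
  Subtype.val_injective.extend_apply t 0 ⟨c, hc⟩

/-- Lifting a rank-metric code along a skeleton: `S` is a parametrized space that is determined by
its coordinates in `A`, and the remaining coordinates are filled with a rank-metric code. Any two
lifted spaces meet in at most a line, some two meet in exactly a line, and the filling can be
prescribed on two independent parameters. -/
theorem exists_lifted_code {F : Type*} [Field F] [Finite F] {U ι : Type*} [AddCommGroup U]
    [Module F U] [FiniteDimensional F U] [Finite ι] (hU : 2 ≤ finrank F U)
    (S : U →ₗ[F] (ι → F)) (A : Set ι) (hS : ∀ x, (∀ c ∈ A, S x c = 0) → x = 0)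
    (hA : finrank F U ≤ Nat.card {c // c ∉ A}) :
    ∃ f : ({c // c ∉ A} → F) × ({c // c ∉ A} → F) → U →ₗ[F] (ι → F),
      (∀ z x, ∀ c ∈ A, f z x c = S x c) ∧ (∀ z, Function.Injective (f z)) ∧
      (∀ z z', z ≠ z' → finrank F
        (LinearMap.range (f z) ⊓ LinearMap.range (f z') : Submodule F (ι → F)) ≤ 1) ∧
      (∃ z z', z ≠ z' ∧ 1 ≤ finrank F
        (LinearMap.range (f z) ⊓ LinearMap.range (f z') : Submodule F (ι → F))) ∧
      ∀ x y, LinearIndependent F ![x, y] → ∀ t : ({c // c ∉ A} → F) × ({c // c ∉ A} → F),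
        ∃ z, f z x = S x + extendOff F A t.1 ∧ f z y = S y + extendOff F A t.2 := by
  have := Fintype.ofFinite ι
  have := Fintype.ofFinite {c // c ∉ A}
  have hT : finrank F ({c // c ∉ A} → F) = Nat.card {c // c ∉ A} := by simp
  obtain ⟨M, hM⟩ := exists_linearMap_finrank_ker_le_one F U ({c // c ∉ A} → F)
    (by omega) (by omega)
  let f : ({c // c ∉ A} → F) × ({c // c ∉ A} → F) → U →ₗ[F] (ι → F) :=
    fun z => S + extendOff F A ∘ₗ M z
  have hfA : ∀ z x, ∀ c ∈ A, f z x c = S x c := fun z x c hc => by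
    simp [f, extendOff_of_mem _ hc]
  have hfn : ∀ z x c (hc : c ∉ A), f z x c = S x c + M z x ⟨c, hc⟩ := fun z x c hc => by
    simp [f, extendOff_of_notMem _ hc]
  have hinj : ∀ z, Function.Injective (f z) := fun z => by
    rw [← LinearMap.ker_eq_bot, LinearMap.ker_eq_bot']
    intro x hx
    exact hS x fun c hc => by rw [← hfA z x c hc, hx]; rfl
  have heq : ∀ z z' x y, f z x = f z' y → x = y ∧ M (z - z') x = 0 := by
    intro z z' x y h
    have hxy : x = y := by
      rw [← sub_eq_zero]
      refine hS _ fun c hc => ?_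
      rw [map_sub, Pi.sub_apply, ← hfA z x c hc, ← hfA z' y c hc, h, sub_self]
    refine ⟨hxy, ?_⟩
    ext ⟨c, hc⟩
    have := congrFun h c
    rw [hfn _ _ _ hc, hfn _ _ _ hc, hxy] at this
    rw [map_sub, LinearMap.sub_apply, Pi.sub_apply, hxy, add_left_cancel this, sub_self]
    rfl
  have heq' : ∀ z z' x, M (z - z') x = 0 → f z x = f z' x := by
    intro z z' x h
    rw [map_sub, LinearMap.sub_apply, sub_eq_zero] at h
    simp [f, h]
  refine ⟨f, hfA, hinj, ?_, ?_, ?_⟩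
  · intro z z' hz
    have hle : (LinearMap.range (f z) ⊓ LinearMap.range (f z') : Submodule F (ι → F))
        ≤ (LinearMap.ker (M (z - z'))).map (f z) := by
      rintro _ ⟨⟨x, rfl⟩, y, hy⟩
      exact ⟨x, (heq z z' x y hy.symm).2, rfl⟩
    exact (Submodule.finrank_mono hle).trans
      ((Submodule.finrank_map_le _ _).trans (hM _ (sub_ne_zero.mpr hz)))
  · have : Nontrivial U := nontrivial_of_finrank_pos (R := F) (by omega)
    obtain ⟨u, hu⟩ := exists_ne (0 : U)
    -- Evaluation at `u` has a kernel, since it halves the dimension.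
    have hker : LinearMap.ker ((LinearMap.applyₗ u).comp M) ≠ ⊥ :=
      LinearMap.ker_ne_bot_of_finrank_lt (by rw [finrank_prod]; omega)
    obtain ⟨z, hz, hz0⟩ := Submodule.exists_mem_ne_zero_of_ne_bot hker
    refine ⟨z, 0, hz0, ?_⟩
    rw [Nat.one_le_iff_ne_zero, ← Nat.pos_iff_ne_zero, finrank_pos_iff,
      Submodule.nontrivial_iff_ne_bot]
    intro hbot
    have : f z u ∈ (LinearMap.range (f z) ⊓ LinearMap.range (f 0) : Submodule F (ι → F)) :=
      ⟨⟨u, rfl⟩, u, (heq' z 0 u (by rw [sub_zero]; exact hz)).symm⟩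
    rw [hbot, Submodule.mem_bot] at this
    exact hu (hinj z (this.trans (map_zero _).symm))
  · intro x y hxy t
    -- A nonzero member of the rank-metric code cannot vanish on a plane, so evaluation at two
    -- independent vectors is injective, hence bijective.
    let g : (({c // c ∉ A} → F) × ({c // c ∉ A} → F)) →ₗ[F]
        (({c // c ∉ A} → F) × ({c // c ∉ A} → F)) :=
      ((LinearMap.applyₗ x).comp M).prod ((LinearMap.applyₗ y).comp M)
    have hg : Function.Injective g := by
      rw [← LinearMap.ker_eq_bot, LinearMap.ker_eq_bot']
      intro z hz
      by_contra hz0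
      have h1 : M z x = 0 := congrArg Prod.fst hz
      have h2 : M z y = 0 := congrArg Prod.snd hz
      have hle : Submodule.span F (Set.range ![x, y]) ≤ LinearMap.ker (M z) := by
        rw [Submodule.span_le]
        rintro _ ⟨i, rfl⟩
        fin_cases i
        · exact h1
        · exact h2
      have h3 := (Submodule.finrank_mono hle).trans (hM z hz0)
      rw [finrank_span_eq_card hxy, Fintype.card_fin] at h3
      omega
    obtain ⟨z, hz⟩ := LinearMap.injective_iff_surjective.mp hg t
    refine ⟨z, ?_, ?_⟩
    · rw [← hz]; rfl
    · rw [← hz]; rfl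

/-- Positions `(ρ, i)` with `2 ≤ ρ < k` and `i ≤ ρ`: the coordinate space consists of one block of
length `ρ + 1` for each `ρ`. -/
def blockPositions (k : ℕ) : Finset (Σ _ : ℕ, ℕ) :=
  (Finset.Ico 2 k).sigma fun ρ => Finset.range (ρ + 1)

theorem mem_blockPositions {k : ℕ} {p : Σ _ : ℕ, ℕ} :
    p ∈ blockPositions k ↔ (2 ≤ p.1 ∧ p.1 < k) ∧ p.2 ≤ p.1 := by
  simp [blockPositions]

/-- Coordinates of the ambient space: the blocks of lengths `3, …, k`, and a tail of length `N`. -/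
abbrev Coord (k N : ℕ) := blockPositions k ⊕ Fin N

/-- The coordinate of the block position `(ρ, i)`. -/
def blockCoord {k : ℕ} (N : ℕ) {ρ i : ℕ} (h2 : 2 ≤ ρ) (hk : ρ < k) (hi : i ≤ ρ) : Coord k N :=
  .inl ⟨⟨ρ, i⟩, mem_blockPositions.mpr ⟨⟨h2, hk⟩, hi⟩⟩

/-- The `ρ`-th entry of a vector of length `k`, read as zero for `ρ ≥ k`. -/
def entry (F : Type*) [Field F] (k ρ : ℕ) : (Fin k → F) →ₗ[F] F :=
  if h : ρ < k then LinearMap.proj ⟨ρ, h⟩ else 0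

theorem entry_of_lt {F : Type*} [Field F] {k ρ : ℕ} (h : ρ < k) (x : Fin k → F) :
    entry F k ρ x = x ⟨ρ, h⟩ := by
  simp [entry, h]

theorem entry_of_le {F : Type*} [Field F] {k ρ : ℕ} (h : k ≤ ρ) (x : Fin k → F) :
    entry F k ρ x = 0 := by
  simp [entry, not_lt.mpr h]

theorem eq_zero_of_entry {F : Type*} [Field F] {k : ℕ} {x : Fin k → F}
    (h : ∀ ρ < k, entry F k ρ x = 0) : x = 0 := by
  ext ⟨ρ, hρ⟩
  exact (entry_of_lt hρ x).symm.trans (h ρ hρ)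

/-- Downward induction from `k` to `m`, for statements that hold beyond `k`. -/
theorem forall_ge_of_step {k m : ℕ} {P : ℕ → Prop} (h0 : ∀ ρ, k ≤ ρ → P ρ)
    (h1 : ∀ ρ, m ≤ ρ → ρ < k → P (ρ + 1) → P ρ) : ∀ ρ, m ≤ ρ → P ρ := by
  have : ∀ d ρ, k ≤ ρ + d → m ≤ ρ → P ρ := by
    intro d
    induction d with
    | zero => exact fun ρ h _ => h0 ρ h
    | succ d ih =>
      intro ρ h hm
      by_cases hk : ρ < k
      · exact h1 ρ hm hk (ih _ (by omega) (by omega))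
      · exact h0 ρ (by omega)
  exact fun ρ hm => this k ρ (by omega) hm

/-- Coordinates in the blocks of index at least `σ`. -/
def upperBlocks (k N σ : ℕ) : Set (Coord k N) :=
  {c | ∃ p, c = .inl p ∧ σ ≤ p.1.1}

/-- The skeleton of level `σ`: row `ρ > σ` is a unit vector at position `σ + 1 ≥ 3` of block `ρ`,
and the rows `0, …, σ` form an identity matrix in block `σ`. -/
def levelSkeleton (F : Type*) [Field F] (k N σ : ℕ) : (Fin k → F) →ₗ[F] (Coord k N → F) :=
  LinearMap.pi fun
    | .inl p => if σ < p.1.1 then if p.1.2 = σ + 1 then entry F k p.1.1 else 0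
        else if p.1.1 = σ then entry F k p.1.2 else 0
    | .inr _ => 0

/-- Coordinates in the blocks, and the two tail coordinates of the edge `e`. -/
def edgeCoords (k : ℕ) {N : ℕ} (e : Edge N) : Set (Coord k N) :=
  {c | ∀ t, c = .inr t → t = e.1.1 ∨ t = e.1.2}

/-- The skeleton of an edge `e` of the complete graph on the tail coordinates, depending on a point
`P` of the projective plane and a label `s`: row `ρ ≥ 2` carries the point `P` in block `ρ`, and,
for `ρ ≥ 3`, the coset representative of `s` modulo `P` in block `ρ - 1`; the rows `0` and `1` are
the unit vectors at the endpoints of `e`. -/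
def edgeSkeleton {F : Type*} [Field F] (k : ℕ) {N : ℕ} (e : Edge N) (P : PlanePoint F)
    (s : F × F) : (Fin k → F) →ₗ[F] (Coord k N → F) :=
  LinearMap.pi fun
    | .inl p => planePoint P p.1.2 • entry F k p.1.1 + planeCoset P s p.1.2 • entry F k (p.1.1 + 1)
    | .inr t => if t = e.1.1 then entry F k 0 else if t = e.1.2 then entry F k 1 else 0

section Skeletons

variable {F : Type*} [Field F] {k N : ℕ}

theorem levelSkeleton_above {σ ρ i : ℕ} (h2 : 2 ≤ ρ) (hk : ρ < k) (hi : i ≤ ρ) (hσ : σ < ρ)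
    (x : Fin k → F) : levelSkeleton F k N σ x (blockCoord N h2 hk hi)
      = if i = σ + 1 then entry F k ρ x else 0 := by
  simp only [levelSkeleton, blockCoord, LinearMap.pi_apply, if_pos hσ]
  split_ifs <;> rfl

theorem levelSkeleton_self {σ i : ℕ} (h2 : 2 ≤ σ) (hk : σ < k) (hi : i ≤ σ)
    (x : Fin k → F) : levelSkeleton F k N σ x (blockCoord N h2 hk hi) = entry F k i x := by
  simp [levelSkeleton, blockCoord]

theorem edgeSkeleton_block {ρ i : ℕ} (h2 : 2 ≤ ρ) (hk : ρ < k) (hi : i ≤ ρ) (e : Edge N)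
    (P : PlanePoint F) (s : F × F) (x : Fin k → F) :
    edgeSkeleton k e P s x (blockCoord N h2 hk hi)
      = entry F k ρ x * planePoint P i + entry F k (ρ + 1) x * planeCoset P s i := by
  simp [edgeSkeleton, blockCoord, mul_comm]

theorem blockCoord_mem_upperBlocks {σ ρ i : ℕ} (h2 : 2 ≤ ρ) (hk : ρ < k) (hi : i ≤ ρ)
    (hσ : σ ≤ ρ) : blockCoord N h2 hk hi ∈ upperBlocks k N σ :=
  ⟨_, rfl, hσ⟩

theorem blockCoord_mem_edgeCoords {ρ i : ℕ} (h2 : 2 ≤ ρ) (hk : ρ < k) (hi : i ≤ ρ) (e : Edge N) :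
    blockCoord N h2 hk hi ∈ edgeCoords k e := by
  intro t h
  cases h

theorem levelSkeleton_injOn {σ : ℕ} (h2 : 2 ≤ σ) (hk : σ < k) (x : Fin k → F)
    (h : ∀ c ∈ upperBlocks k N σ, levelSkeleton F k N σ x c = 0) : x = 0 := by
  refine eq_zero_of_entry fun ρ hρ => ?_
  rcases le_or_gt ρ σ with hρσ | hρσ
  · rw [← levelSkeleton_self (N := N) h2 hk hρσ]
    exact h _ (blockCoord_mem_upperBlocks _ _ _ le_rfl)
  · have := h _ (blockCoord_mem_upperBlocks (N := N) (by omega) hρ hρσ hρσ.le)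
    rwa [levelSkeleton_above _ _ _ hρσ, if_pos rfl] at this

theorem edgeSkeleton_injOn (e : Edge N) (P : PlanePoint F) (s : F × F) (x : Fin k → F)
    (h : ∀ c ∈ edgeCoords k e, edgeSkeleton k e P s x c = 0) : x = 0 := by
  have h2 : ∀ ρ, 2 ≤ ρ → entry F k ρ x = 0 := by
    refine forall_ge_of_step (fun ρ hρ => entry_of_le hρ x) fun ρ hρ hk ih => ?_
    refine eq_zero_of_mul_planePoint_eq_zero (P := P) fun i hi => ?_
    have := h _ (blockCoord_mem_edgeCoords (i := i) hρ hk (by omega) e)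
    rwa [edgeSkeleton_block, ih, zero_mul, add_zero] at this
  refine eq_zero_of_entry fun ρ hρ => ?_
  have h0 := h (.inr e.1.1) (fun t ht => Or.inl (Sum.inr.inj ht).symm)
  have h1 := h (.inr e.1.2) (fun t ht => Or.inr (Sum.inr.inj ht).symm)
  simp only [edgeSkeleton, LinearMap.pi_apply, if_pos, if_neg e.2.ne'] at h0 h1
  rcases ρ with _ | _ | ρ
  · exact h0
  · exact h1
  · exact h2 _ (by omega)

theorem card_notMem_upperBlocks {σ : ℕ} (h2 : 2 ≤ σ) :
    Nat.card {c // c ∉ upperBlocks k N σ} + ∑ ρ ∈ Finset.Ico σ k, (ρ + 1)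
      = Nat.card (Coord k N) := by
  classical
  let B := (Finset.Ico σ k).sigma fun ρ => Finset.range (ρ + 1)
  have hB : B.card = ∑ ρ ∈ Finset.Ico σ k, (ρ + 1) := by simp [B]
  have hmem : ∀ p, p ∈ B ↔ (σ ≤ p.1 ∧ p.1 < k) ∧ p.2 ≤ p.1 := fun p => by simp [B]
  let g : B → {c // c ∈ upperBlocks k N σ} := fun p =>
    have hp := (hmem p.1).mp p.2
    ⟨.inl ⟨p.1, mem_blockPositions.mpr ⟨⟨h2.trans hp.1.1, hp.1.2⟩, hp.2⟩⟩, _, rfl, hp.1.1⟩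
  have hg : Function.Bijective g := by
    constructor
    · intro p p' h
      have h' : (Sum.inl _ : Coord k N) = Sum.inl _ := congrArg Subtype.val h
      have h'' := congrArg Subtype.val (Sum.inl.inj h')
      exact Subtype.ext h''
    · rintro ⟨_, p, rfl, hp⟩
      have h' := mem_blockPositions.mp p.2
      exact ⟨⟨p.1, (hmem _).mpr ⟨⟨hp, h'.1.2⟩, h'.2⟩⟩, rfl⟩
  have h1 := Nat.card_eq_of_bijective g hg
  rw [Nat.card_eq_fintype_card, Fintype.card_coe, hB] at h1
  have h3 := Fintype.card_subtype_le fun c => c ∈ upperBlocks k N σ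
  rw [h1]
  simp only [Nat.card_eq_fintype_card]
  rw [Fintype.card_subtype_compl, Nat.sub_add_cancel h3]

theorem le_card_notMem_edgeCoords (e : Edge N) : N - 2 ≤ Nat.card {c // c ∉ edgeCoords k e} := by
  classical
  let g : {t : Fin N // t ∉ ({e.1.1, e.1.2} : Finset (Fin N))} → {c // c ∉ edgeCoords k e} :=
    fun t => ⟨.inr t.1, fun h => t.2 (by simpa using h t.1 rfl)⟩
  have hg : Function.Injective g := fun t t' h =>
    Subtype.ext (Sum.inr.inj (congrArg Subtype.val h))
  refine le_trans ?_ (Nat.card_le_card_of_injective g hg)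
  have := Finset.card_le_two (a := e.1.1) (b := e.1.2)
  rw [Nat.card_eq_fintype_card, Fintype.card_subtype_compl, Fintype.card_fin, Fintype.card_coe]
  omega

end Skeletons

/-! ### Intersections of codewords -/

section Intersections

variable {F : Type*} [Field F] {k N : ℕ}

/-- Above block `σ` the unit vectors of the two levels are distinct, and block `σ` is a multiple of
a fixed vector in the lower level, so a common vector is determined by one scalar. -/
theorem finrank_inf_le_one_of_levels {σ σ' : ℕ} (h2 : 2 ≤ σ') (hσ : σ' < σ) (hk : σ < k)
    {f g : (Fin k → F) →ₗ[F] (Coord k N → F)}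
    (hf : ∀ x, ∀ c ∈ upperBlocks k N σ, f x c = levelSkeleton F k N σ x c)
    (hg : ∀ x, ∀ c ∈ upperBlocks k N σ', g x c = levelSkeleton F k N σ' x c) :
    finrank F (LinearMap.range f ⊓ LinearMap.range g : Submodule F (Coord k N → F)) ≤ 1 := by
  refine finrank_range_inf_range_le_one f g (entry F k σ ∘ₗ LinearMap.snd F _ _) ?_
  intro x y h hl
  have hl : entry F k σ y = 0 := hl
  have key : ∀ ρ i (hρk : ρ < k) (hi : i ≤ ρ) (hρ : σ ≤ ρ),
      levelSkeleton F k N σ x (blockCoord N (by omega) hρk hi)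
        = if i = σ' + 1 then entry F k ρ y else 0 := by
    intro ρ i hρk hi hρ
    rw [← hf x _ (blockCoord_mem_upperBlocks _ _ _ hρ), h,
      hg y _ (blockCoord_mem_upperBlocks _ _ _ (by omega)),
      levelSkeleton_above _ _ _ (by omega)]
  suffices x = 0 by rw [this, map_zero]
  refine eq_zero_of_entry fun ρ hρ => ?_
  rcases le_or_gt ρ σ with hρσ | hρσ
  · have := key σ ρ hk hρσ le_rfl
    rwa [levelSkeleton_self, hl, ite_self] at this
  · have := key ρ (σ + 1) hρ hρσ hρσ.le
    rwa [levelSkeleton_above _ _ _ hρσ, if_pos rfl, if_neg (by omega)] at this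

/-- The unit vectors of a level and the points of the projective plane have disjoint supports, so
the rows of the blocks above `σ` do not contribute to a common vector. -/
theorem finrank_inf_le_one_of_level_edge {σ : ℕ} (h2 : 2 ≤ σ) (hk : σ < k) {e : Edge N}
    {P : PlanePoint F} {s : F × F} {f g : (Fin k → F) →ₗ[F] (Coord k N → F)}
    (hf : ∀ x, ∀ c ∈ upperBlocks k N σ, f x c = levelSkeleton F k N σ x c)
    (hg : ∀ x, ∀ c ∈ edgeCoords k e, g x c = edgeSkeleton k e P s x c) :
    finrank F (LinearMap.range f ⊓ LinearMap.range g : Submodule F (Coord k N → F)) ≤ 1 := by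
  refine finrank_range_inf_range_le_one f g (entry F k σ ∘ₗ LinearMap.snd F _ _) ?_
  intro x y h hl
  have hl : entry F k σ y = 0 := hl
  have key : ∀ ρ i (hρk : ρ < k) (hi : i ≤ ρ) (hρ : σ ≤ ρ),
      levelSkeleton F k N σ x (blockCoord N (by omega) hρk hi)
        = entry F k ρ y * planePoint P i + entry F k (ρ + 1) y * planeCoset P s i := by
    intro ρ i hρk hi hρ
    rw [← hf x _ (blockCoord_mem_upperBlocks _ _ _ hρ), h,
      hg y _ (blockCoord_mem_edgeCoords _ _ _ _), edgeSkeleton_block]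
  -- Block `ρ > σ` of the first space vanishes at the three positions used by the second one.
  have hy : ∀ ρ, σ + 1 ≤ ρ → entry F k ρ y = 0 := by
    refine forall_ge_of_step (fun ρ hρ => entry_of_le hρ y) fun ρ hρ hρk ih => ?_
    refine eq_zero_of_mul_planePoint_eq_zero (P := P) fun i hi => ?_
    have := key ρ i hρk (by omega) (by omega)
    rw [levelSkeleton_above _ _ _ hρ, if_neg (by omega), ih, zero_mul, add_zero] at this
    exact this.symm
  suffices x = 0 by rw [this, map_zero]
  refine eq_zero_of_entry fun ρ hρ => ?_
  rcases le_or_gt ρ σ with hρσ | hρσ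
  · have := key σ ρ hk hρσ le_rfl
    rwa [levelSkeleton_self, hl, hy _ le_rfl, zero_mul, zero_mul, add_zero] at this
  · have := key ρ (σ + 1) hρ hρσ hρσ.le
    rwa [levelSkeleton_above _ _ _ hρσ, if_pos rfl, hy ρ hρσ, hy (ρ + 1) (by omega), zero_mul,
      zero_mul, add_zero] at this

/-- A lifted codeword over the plane `W`: its block part is that of an edge skeleton, and the rows
`0` and `1` span the plane `W` of tail vectors. -/
structure IsOverPlane (P : PlanePoint F) (s : F × F) (W : Submodule F (Fin N → F))
    (f : (Fin k → F) →ₗ[F] (Coord k N → F)) : Prop where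
  block : ∀ x {ρ i : ℕ} (h2 : 2 ≤ ρ) (hk : ρ < k) (hi : i ≤ ρ), f x (blockCoord N h2 hk hi)
    = entry F k ρ x * planePoint P i + entry F k (ρ + 1) x * planeCoset P s i
  tail : ∀ x, (∀ ρ, 2 ≤ ρ → entry F k ρ x = 0) → (fun t => f x (.inr t)) ∈ W

theorem IsOverPlane.block_eq_zero {P : PlanePoint F} {s : F × F} {W : Submodule F (Fin N → F)}
    {f : (Fin k → F) →ₗ[F] (Coord k N → F)} (hf : IsOverPlane P s W f) {x : Fin k → F}
    (hx : ∀ ρ, 2 ≤ ρ → entry F k ρ x = 0) (p : blockPositions k) : f x (.inl p) = 0 := by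
  obtain ⟨⟨ρ, i⟩, hp⟩ := p
  obtain ⟨⟨h2, hk⟩, hi⟩ := mem_blockPositions.mp hp
  exact (hf.block x h2 hk hi).trans (by rw [hx ρ h2, hx _ (by omega), zero_mul, zero_mul, add_zero])

/-- Distinct points kill all block rows, leaving the intersection of the two planes. -/
theorem IsOverPlane.finrank_inf_le_one_of_ne {P P' : PlanePoint F} (hP : P ≠ P') {s s' : F × F}
    {W W' : Submodule F (Fin N → F)} (hWW : finrank F (W ⊓ W' : Submodule F (Fin N → F)) ≤ 1)
    {f g : (Fin k → F) →ₗ[F] (Coord k N → F)} (hf : IsOverPlane P s W f)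
    (hg : IsOverPlane P' s' W' g) :
    finrank F (LinearMap.range f ⊓ LinearMap.range g : Submodule F (Coord k N → F)) ≤ 1 := by
  let ι : (Fin N → F) →ₗ[F] (Coord k N → F) :=
    LinearMap.pi fun | .inl _ => 0 | .inr t => LinearMap.proj t
  have hle : (LinearMap.range f ⊓ LinearMap.range g : Submodule F (Coord k N → F))
      ≤ (W ⊓ W').map ι := by
    rintro _ ⟨⟨x, rfl⟩, y, hxy⟩
    have hzero : ∀ ρ, 2 ≤ ρ → entry F k ρ x = 0 ∧ entry F k ρ y = 0 := by
      refine forall_ge_of_step (fun ρ hρ => ⟨entry_of_le hρ x, entry_of_le hρ y⟩) ?_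
      intro ρ h2 hk ih
      refine eq_zero_of_mul_planePoint_eq hP fun i hi => ?_
      have := congrFun hxy.symm (blockCoord N h2 hk (i := i) (by omega))
      rwa [hf.block, hg.block, ih.1, ih.2, zero_mul, zero_mul, add_zero, add_zero] at this
    have hx := fun ρ h => (hzero ρ h).1
    refine ⟨fun t => f x (.inr t), ⟨hf.tail x hx, ?_⟩, ?_⟩
    · rw [← hxy]
      exact hg.tail y fun ρ h => (hzero ρ h).2
    · ext (p | t)
      · exact (hf.block_eq_zero hx p).symm
      · rfl
  exact (Submodule.finrank_mono hle).trans ((Submodule.finrank_map_le _ _).trans hWW)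

theorem IsOverPlane.finrank_inf_le_one_of_disjoint {P : PlanePoint F} {s s' : F × F}
    (hs : s ≠ s') {W W' : Submodule F (Fin N → F)} (hWW : W ⊓ W' = ⊥)
    {f g : (Fin k → F) →ₗ[F] (Coord k N → F)} (hf : IsOverPlane P s W f)
    (hg : IsOverPlane P s' W' g) :
    finrank F (LinearMap.range f ⊓ LinearMap.range g : Submodule F (Coord k N → F)) ≤ 1 := by
  refine finrank_range_inf_range_le_one f g (entry F k 2 ∘ₗ LinearMap.fst F _ _) ?_
  intro x y hxy hl
  have hl : entry F k 2 x = 0 := hl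
  -- The labels differ modulo the common point, so only the entry of index 2 survives.
  have heq : ∀ ρ, 2 ≤ ρ → entry F k ρ x = entry F k ρ y ∧ entry F k (ρ + 1) x = 0 := by
    refine forall_ge_of_step (fun ρ hρ => ⟨?_, entry_of_le (Nat.le_succ_of_le hρ) x⟩) ?_
    · rw [entry_of_le hρ, entry_of_le hρ]
    intro ρ h2 hk ih
    refine eq_zero_of_mul_planePoint_add_eq (P := P) hs fun i hi => ?_
    have := congrFun hxy (blockCoord N h2 hk (i := i) (by omega))
    rwa [hf.block, hg.block, ← ih.1] at this
  have hx : ∀ ρ, 2 ≤ ρ → entry F k ρ x = 0 := by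
    intro ρ h2
    rcases h2.eq_or_lt with rfl | h3
    · exact hl
    · obtain ⟨ρ, rfl⟩ := Nat.exists_eq_add_of_lt h3
      exact (heq (2 + ρ) (by omega)).2
  have hy : ∀ ρ, 2 ≤ ρ → entry F k ρ y = 0 := fun ρ h => (heq ρ h).1 ▸ hx ρ h
  have hmem : (fun t => f x (.inr t)) ∈ W ⊓ W' := by
    refine ⟨hf.tail x hx, ?_⟩
    rw [hxy]
    exact hg.tail y hy
  rw [hWW, Submodule.mem_bot] at hmem
  ext (p | t)
  · exact hf.block_eq_zero hx p
  · exact congrFun hmem t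

/-- Codewords over all planes with a given pair of pivots. The argument `w` is the reduced basis of
the plane. -/
theorem exists_codewords_over_edge [Finite F] (hk : 3 ≤ k) (hN : k + 2 ≤ N) (e : Edge N)
    (P : PlanePoint F) (s : F × F) :
    ∃ f : (Fin N → F) × (Fin N → F) → (Fin k → F) →ₗ[F] (Coord k N → F),
      (∀ w, Function.Injective (f w)) ∧
      (∀ w x, ∀ c ∈ edgeCoords k e, f w x c = edgeSkeleton k e P s x c) ∧
      ∀ w : (Fin N → F) × (Fin N → F), w.1 e.1.1 = 1 → w.1 e.1.2 = 0 → w.2 e.1.1 = 0 →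
        w.2 e.1.2 = 1 → (∀ W : Submodule F (Fin N → F), w.1 ∈ W → w.2 ∈ W →
          IsOverPlane P s W (f w)) ∧
        ∀ w' : (Fin N → F) × (Fin N → F), w'.1 e.1.1 = 1 → w'.1 e.1.2 = 0 → w'.2 e.1.1 = 0 →
          w'.2 e.1.2 = 1 → w ≠ w' → finrank F (LinearMap.range (f w) ⊓ LinearMap.range (f w') :
            Submodule F (Coord k N → F)) ≤ 1 := by
  obtain ⟨g, hg, hinj, hinf, -, hpre⟩ := exists_lifted_code
    (by rw [finrank_fin_fun]; omega) (edgeSkeleton k e P s) (edgeCoords k e)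
    (edgeSkeleton_injOn e P s)
    (by rw [finrank_fin_fun]; exact le_trans (by omega) (le_card_notMem_edgeCoords e))
  let u : Fin k → F := Pi.single ⟨0, by omega⟩ 1
  let v : Fin k → F := Pi.single ⟨1, by omega⟩ 1
  have huv : LinearIndependent F ![u, v] := by
    rw [LinearIndependent.pair_iff]
    intro a b h
    have h0 := congrFun h ⟨0, by omega⟩
    have h1 := congrFun h ⟨1, by omega⟩
    simp [u, v] at h0 h1
    exact ⟨h0, h1⟩
  let tl : (Fin N → F) → {c // c ∉ edgeCoords k e} → F := fun a c =>
    Sum.elim (fun _ => 0) a c.1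
  choose z hzu hzv using fun w : (Fin N → F) × (Fin N → F) => hpre u v huv (tl w.1, tl w.2)
  have hu0 : entry F k 0 u = 1 := by rw [entry_of_lt (by omega)]; simp [u]
  have hu1 : entry F k 1 u = 0 := by rw [entry_of_lt (by omega)]; simp [u]
  have hv0 : entry F k 0 v = 0 := by rw [entry_of_lt (by omega)]; simp [v]
  have hv1 : entry F k 1 v = 1 := by rw [entry_of_lt (by omega)]; simp [v]
  have hmem : ∀ t, (t = e.1.1 ∨ t = e.1.2) → (Sum.inr t : Coord k N) ∈ edgeCoords k e := by
    rintro t ht t' h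
    rwa [← Sum.inr.inj h]
  have hnot : ∀ t, t ≠ e.1.1 → t ≠ e.1.2 → (Sum.inr t : Coord k N) ∉ edgeCoords k e :=
    fun t h1 h2 h => (h t rfl).elim h1 h2
  have hwu : ∀ w : (Fin N → F) × (Fin N → F), w.1 e.1.1 = 1 → w.1 e.1.2 = 0 →
      ∀ t, g (z w) u (.inr t) = w.1 t := by
    intro w h1 h2 t
    rw [hzu, Pi.add_apply]
    by_cases ht1 : t = e.1.1
    · rw [extendOff_of_mem _ (hmem t (Or.inl ht1))]
      simp [edgeSkeleton, ht1, hu0, h1]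
    · by_cases ht2 : t = e.1.2
      · rw [extendOff_of_mem _ (hmem t (Or.inr ht2))]
        simp [edgeSkeleton, ht2, hu1, h2, e.2.ne']
      · rw [extendOff_of_notMem _ (hnot t ht1 ht2)]
        simp [edgeSkeleton, ht1, ht2, tl]
  have hwv : ∀ w : (Fin N → F) × (Fin N → F), w.2 e.1.1 = 0 → w.2 e.1.2 = 1 →
      ∀ t, g (z w) v (.inr t) = w.2 t := by
    intro w h1 h2 t
    rw [hzv, Pi.add_apply]
    by_cases ht1 : t = e.1.1
    · rw [extendOff_of_mem _ (hmem t (Or.inl ht1))]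
      simp [edgeSkeleton, ht1, hv0, h1]
    · by_cases ht2 : t = e.1.2
      · rw [extendOff_of_mem _ (hmem t (Or.inr ht2))]
        simp [edgeSkeleton, ht2, hv1, h2, e.2.ne']
      · rw [extendOff_of_notMem _ (hnot t ht1 ht2)]
        simp [edgeSkeleton, ht1, ht2, tl]
  refine ⟨fun w => g (z w), fun w => hinj _, fun w => hg _, ?_⟩
  intro w h1 h2 h3 h4
  refine ⟨fun W hW1 hW2 => ⟨?_, ?_⟩, ?_⟩
  · intro x ρ i hρ hρk hi
    rw [hg _ _ _ (blockCoord_mem_edgeCoords _ _ _ _), edgeSkeleton_block]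
  · intro x hx
    have hxuv : x = entry F k 0 x • u + entry F k 1 x • v := by
      rw [← sub_eq_zero]
      refine eq_zero_of_entry fun ρ hρ => ?_
      rcases ρ with _ | _ | ρ
      · simp [hu0, hv0]
      · simp [hu1, hv1]
      · have h5 : entry F k (ρ + 2) u = 0 := by
          rw [entry_of_lt (by omega)]; simp [u]
        have h6 : entry F k (ρ + 2) v = 0 := by
          rw [entry_of_lt (by omega)]; simp [v]
        simp [hx (ρ + 2) (by omega), h5, h6]
    have : (fun t => g (z w) x (.inr t)) = entry F k 0 x • w.1 + entry F k 1 x • w.2 := by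
      ext t
      rw [hxuv, map_add, map_smul, map_smul, ← hxuv]
      simp only [Pi.add_apply, Pi.smul_apply, hwu w h1 h2, hwv w h3 h4]
    rw [this]
    exact W.add_mem (W.smul_mem _ hW1) (W.smul_mem _ hW2)
  · intro w' h1' h2' h3' h4' hne
    refine hinf _ _ fun h => hne (Prod.ext ?_ ?_)
    · ext t
      rw [← hwu w h1 h2, h, hwu w' h1' h2']
    · ext t
      rw [← hwv w h3 h4, h, hwv w' h3' h4']

end Intersections

/-! ### The code and its size -/

/-- The code consisting of all lifted spaces over the level skeletons together with one space over
every plane of the tail space. -/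
theorem sum_pow_add_card_planes_le_maxCodeSize (F : Type*) [Field F] [Fintype F] {k N ℓ : ℕ}
    (hk : 3 ≤ k) (hN : k + 2 ≤ N) (hℓ : Odd ℓ) (hNℓ : N ≤ ℓ + 1)
    (hℓq : ℓ ≤ Fintype.card F ^ 2 + Fintype.card F + 1) :
    (∑ σ ∈ Finset.Ico 2 k,
        Fintype.card F ^ (2 * (Nat.card (Coord k N) - ∑ ρ ∈ Finset.Ico σ k, (ρ + 1))))
      + Nat.card {W : Submodule F (Fin N → F) // finrank F W = 2}
      ≤ maxCodeSize F (Nat.card (Coord k N)) (k - 1) k := by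
  classical
  have hq : 2 ≤ Fintype.card F := Fintype.one_lt_card
  obtain ⟨c, hc⟩ := exists_edge_coloring hℓ hNℓ
  obtain ⟨s, hs⟩ := exists_label_injOn_colors (β := F × F) c hc (by
    rw [Nat.card_eq_fintype_card, Fintype.card_prod]
    nlinarith)
  obtain ⟨P⟩ : Nonempty (Fin ℓ ↪ PlanePoint F) := by
    rw [Function.Embedding.nonempty_iff_card_le, card_planePoint, Fintype.card_fin]
    exact hℓq
  choose g hginj hgS hg using fun e : Edge N => exists_codewords_over_edge hk hN e (P (c e)) (s e)
  let Pl := {W : Submodule F (Fin N → F) // finrank F W = 2}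
  choose e' w he hw1 hw2 h11 h12 h21 h22 hexp hlead using
    fun W : Pl => exists_reduced_basis W.1 W.2
  let e : Pl → Edge N := fun W => ⟨e' W, he W⟩
  let h : Pl → (Fin k → F) →ₗ[F] (Coord k N → F) := fun W => g (e W) (w W)
  have hh : ∀ W : Pl, IsOverPlane (P (c (e W))) (s (e W)) W.1 (h W) := fun W =>
    (hg (e W) (w W) (h11 W) (h12 W) (h21 W) (h22 W)).1 W.1 (hw1 W) (hw2 W)
  have hhh : ∀ W W' : Pl, W ≠ W' → finrank F
      (LinearMap.range (h W) ⊓ LinearMap.range (h W') : Submodule F (Coord k N → F)) ≤ 1 := by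
    intro W W' hne
    by_cases hee : e W = e W'
    · have hee' : e' W = e' W' := congrArg Subtype.val hee
      have hww : w W ≠ w W' := by
        intro hww
        have hle : ∀ V V' : Pl, w V = w V' → V.1 ≤ V'.1 := by
          intro V V' hVV v hv
          rw [hexp V v hv, hVV]
          exact V'.1.add_mem (V'.1.smul_mem _ (hw1 V')) (V'.1.smul_mem _ (hw2 V'))
        exact hne (Subtype.ext (le_antisymm (hle W W' hww) (hle W' W hww.symm)))
      have := (hg (e W) (w W) (h11 W) (h12 W) (h21 W) (h22 W)).2 (w W')
        (by rw [hee]; exact h11 W') (by rw [hee]; exact h12 W') (by rw [hee]; exact h21 W')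
        (by rw [hee]; exact h22 W') hww
      rwa [show h W' = g (e W) (w W') by rw [hee]]
    by_cases hcc : c (e W) = c (e W')
    · -- Edges of the same colour are disjoint, so a common vector has no possible leading position.
      have hdisj : W.1 ⊓ W'.1 = ⊥ := by
        by_contra hbot
        obtain ⟨v, hv, hv0⟩ := Submodule.exists_mem_ne_zero_of_ne_bot hbot
        obtain ⟨t, ht, hvt, hlt⟩ := hlead W v hv.1 hv0
        obtain ⟨t', ht', hvt', hlt'⟩ := hlead W' v hv.2 hv0
        have htt : t = t' := by
          rcases lt_trichotomy t t' with hlt'' | heq | hlt''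
          · exact absurd (hlt' t hlt'') hvt
          · exact heq
          · exact absurd (hlt t' hlt'') hvt'
        refine hc _ _ hee ?_ hcc
        subst htt
        rcases ht with ht | ht <;> rcases ht' with ht' | ht'
        · exact Or.inl (ht.symm.trans ht')
        · exact Or.inr (Or.inl (ht.symm.trans ht'))
        · exact Or.inr (Or.inr (Or.inl (ht.symm.trans ht')))
        · exact Or.inr (Or.inr (Or.inr (ht.symm.trans ht')))
      have hW' := hh W'
      rw [← hcc] at hW'
      exact (hh W).finrank_inf_le_one_of_disjoint (fun h' => hee (hs _ _ hcc h')) hdisj hW'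
    · refine (hh W).finrank_inf_le_one_of_ne (P.injective.ne hcc) ?_ (hh W')
      have hle := Submodule.finrank_mono (inf_le_left : W.1 ⊓ W'.1 ≤ W.1)
      rw [W.2] at hle
      by_contra hgt
      have hfin : finrank F (W.1 ⊓ W'.1 : Submodule F (Fin N → F)) = 2 := by omega
      have h1 := Submodule.eq_of_le_of_finrank_eq (inf_le_left : W.1 ⊓ W'.1 ≤ W.1)
        (by rw [hfin, W.2])
      have h2 := Submodule.eq_of_le_of_finrank_eq (inf_le_right : W.1 ⊓ W'.1 ≤ W'.1)
        (by rw [hfin, W'.2])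
      exact hne (Subtype.ext (h1.symm.trans h2))
  have hcard : ∀ σ : Finset.Ico 2 k, Nat.card {x // x ∉ upperBlocks k N σ.1}
      = Nat.card (Coord k N) - ∑ ρ ∈ Finset.Ico σ.1 k, (ρ + 1) := fun σ =>
    Nat.eq_sub_of_add_eq (card_notMem_upperBlocks (Finset.mem_Ico.mp σ.2).1)
  have hlarge : ∀ σ : Finset.Ico 2 k, k ≤ Nat.card {x // x ∉ upperBlocks k N σ.1} := by
    intro σ
    have := Nat.card_le_card_of_injective
      (fun t : Fin N => (⟨.inr t, by rintro ⟨p, hp, -⟩; cases hp⟩ :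
        {x // x ∉ upperBlocks k N σ.1}))
      (fun t t' h => Sum.inr.inj (congrArg Subtype.val h))
    rw [Nat.card_fin] at this
    omega
  choose f hfS hfinj hff hfex _ using fun σ : Finset.Ico 2 k =>
    exists_lifted_code (by rw [finrank_fin_fun]; omega) (levelSkeleton F k N σ.1)
      (upperBlocks k N σ.1)
      (levelSkeleton_injOn (Finset.mem_Ico.mp σ.2).1 (Finset.mem_Ico.mp σ.2).2)
      (by rw [finrank_fin_fun]; exact hlarge σ)
  let T : Finset.Ico 2 k → Type _ := fun σ =>
    ({x // x ∉ upperBlocks k N σ.1} → F) × ({x // x ∉ upperBlocks k N σ.1} → F)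
  let m : (Σ σ, T σ) ⊕ Pl → (Fin k → F) →ₗ[F] (Coord k N → F) :=
    Sum.elim (fun z => f z.1 z.2) h
  have hm : ∀ i, Function.Injective (m i) := by
    rintro (z | W)
    · exact hfinj _ _
    · exact hginj _ _
  have hlevel : ∀ z z' : Σ σ, T σ, z'.1.1 < z.1.1 → finrank F (LinearMap.range (f z.1 z.2) ⊓
      LinearMap.range (f z'.1 z'.2) : Submodule F (Coord k N → F)) ≤ 1 := fun z z' hlt =>
    finrank_inf_le_one_of_levels (Finset.mem_Ico.mp z'.1.2).1 hlt (Finset.mem_Ico.mp z.1.2).2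
      (hfS z.1 z.2) (hfS z'.1 z'.2)
  have hmixed : ∀ (z : Σ σ, T σ) (W : Pl), finrank F (LinearMap.range (f z.1 z.2) ⊓
      LinearMap.range (h W) : Submodule F (Coord k N → F)) ≤ 1 := fun z W =>
    finrank_inf_le_one_of_level_edge (Finset.mem_Ico.mp z.1.2).1 (Finset.mem_Ico.mp z.1.2).2
      (hfS z.1 z.2) (hgS (e W) (w W))
  have hmm : ∀ i j, i ≠ j → finrank F
      (LinearMap.range (m i) ⊓ LinearMap.range (m j) : Submodule F (Coord k N → F)) ≤ 1 := by
    rintro (z | W) (z' | W') hne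
    · rcases lt_trichotomy z.1.1 z'.1.1 with hlt | heq | hlt
      · rw [inf_comm]
        exact hlevel z' z hlt
      · obtain ⟨σ, z⟩ := z
        obtain ⟨σ', z'⟩ := z'
        obtain rfl : σ = σ' := Subtype.ext heq
        exact hff σ z z' fun hz => hne (by rw [hz])
      · exact hlevel z z' hlt
    · exact hmixed z W'
    · rw [inf_comm]
      exact hmixed z' W
    · exact hhh W W' fun hW => hne (by rw [hW])
  obtain ⟨z, z', hzz, hz⟩ := hfex ⟨2, Finset.mem_Ico.mpr ⟨le_rfl, hk⟩⟩
  have hT : ∀ σ, Nat.card (T σ)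
      = Fintype.card F ^ (2 * (Nat.card (Coord k N) - ∑ ρ ∈ Finset.Ico σ.1 k, (ρ + 1))) := by
    intro σ
    rw [← hcard, Nat.card_prod, Nat.card_fun, Nat.card_eq_fintype_card (α := F), ← pow_add,
      ← two_mul]
  have hfinal := card_le_maxCodeSize (F := F) (E := Coord k N → F) (n := Nat.card (Coord k N))
    (k := k) (by rw [finrank_fintype_fun_eq_card, Nat.card_eq_fintype_card]) (by omega)
    (fun i => LinearMap.range (m i))
    (fun i => by rw [LinearMap.finrank_range_of_inj (hm i), finrank_fin_fun]) hmm
    (i₀ := .inl ⟨_, z⟩) (j₀ := .inl ⟨_, z'⟩)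
    (fun h' => hzz (by simpa using h')) hz
  rw [Nat.card_sum, Nat.card_sigma, Finset.sum_congr rfl fun σ _ => hT σ,
    Finset.sum_coe_sort (Finset.Ico 2 k) fun σ =>
      Fintype.card F ^ (2 * (Nat.card (Coord k N) - ∑ ρ ∈ Finset.Ico σ k, (ρ + 1)))] at hfinal
  exact hfinal

theorem two_mul_sum_Ico_add_six {k : ℕ} (hk : 2 ≤ k) :
    2 * ∑ ρ ∈ Finset.Ico 2 k, (ρ + 1) + 6 = k ^ 2 + k := by
  induction k, hk using Nat.le_induction with
  | base => simp
  | succ k hk ih =>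
    rw [Finset.sum_Ico_succ_top hk]
    nlinarith

end SubspaceCode

theorem mainTheorem3 (F : Type*) [Field F] [Fintype F] (q : ℕ) (hq : Fintype.card F = q)
    (n k : ℕ) (hk : 3 ≤ k) (hn : (k ^ 2 + 3 * k - 2) / 2 ≤ n)
    (ℓ : ℕ)
    (hℓ : ℓ = if Odd (n - (k ^ 2 + k - 6) / 2)
      then n - (k ^ 2 + k - 6) / 2 else n - (k ^ 2 + k - 4) / 2)
    (hqℓ : ℓ ≤ q ^ 2 + q + 1) :
    (q : ℚ) ^ (2 * (n - k))
        + ∑ j ∈ Finset.Icc 3 (k - 1), (q : ℚ) ^ (2 * (n - ∑ i ∈ Finset.Icc j k, i))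
        + SubspaceCode.gaussianCoeff q (n - (k ^ 2 + k - 6) / 2) 2
      ≤ (SubspaceCode.maxCodeSize F n (k - 1) k : ℚ) := by
  subst hq
  have hsum := SubspaceCode.two_mul_sum_Ico_add_six (k := k) (by omega)
  set B := ∑ ρ ∈ Finset.Ico 2 k, (ρ + 1) with hB
  have hB1 : (k ^ 2 + k - 6) / 2 = B := by omega
  have hB2 : (k ^ 2 + k - 4) / 2 = B + 1 := by omega
  rw [hB1, hB2] at hℓ
  rw [hB1]
  obtain ⟨N, hN⟩ : ∃ N, n - B = N := ⟨_, rfl⟩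
  have hNk : k + 2 ≤ N := by omega
  have hcoord : Nat.card (SubspaceCode.Coord k N) = n := by
    have : Nat.card (SubspaceCode.Coord k N) = B + N := by
      rw [Nat.card_sum, Nat.card_fin, Nat.card_eq_fintype_card, Fintype.card_coe]
      simp [SubspaceCode.blockPositions, hB]
    omega
  have hℓ' : Odd ℓ ∧ N ≤ ℓ + 1 := by
    rw [hN] at hℓ
    split_ifs at hℓ with hodd
    · exact ⟨hℓ ▸ hodd, by omega⟩
    · rw [Nat.not_odd_iff_even] at hodd
      have : ℓ + 1 = N := by omega
      refine ⟨?_, this.ge⟩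
      rw [← this, Nat.even_add_one, Nat.not_even_iff_odd] at hodd
      exact hodd
  have key := SubspaceCode.sum_pow_add_card_planes_le_maxCodeSize F hk hNk hℓ'.1 hℓ'.2 hqℓ
  rw [hcoord] at key
  have hplanes := SubspaceCode.card_finrank_eq_two (F := F) (V := Fin N → F)
    (by rw [Module.finrank_fin_fun]; omega)
  rw [Module.finrank_fin_fun] at hplanes
  have hshift : ∀ σ, ∑ ρ ∈ Finset.Ico σ k, (ρ + 1) = ∑ i ∈ Finset.Icc (σ + 1) k, i := by
    intro σ
    rw [Finset.sum_Ico_add' (fun i => i) σ k 1]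
    rfl
  have htotal : ∑ σ ∈ Finset.Ico 2 k,
      Fintype.card F ^ (2 * (n - ∑ ρ ∈ Finset.Ico σ k, (ρ + 1)))
      = Fintype.card F ^ (2 * (n - k)) + ∑ j ∈ Finset.Icc 3 (k - 1),
        Fintype.card F ^ (2 * (n - ∑ i ∈ Finset.Icc j k, i)) := by
    simp only [hshift]
    rw [Finset.sum_Ico_add' (fun j => Fintype.card F ^ (2 * (n - ∑ i ∈ Finset.Icc j k, i))) 2 k 1,
      Finset.sum_Ico_succ_top (by omega), Finset.Icc_self, Finset.sum_singleton, add_comm]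
    have hIcc : Finset.Ico (2 + 1) k = Finset.Icc 3 (k - 1) := by
      ext j
      simp only [Finset.mem_Ico, Finset.mem_Icc]
      omega
    rw [hIcc]
  rw [htotal] at key
  rw [hN, ← hplanes]
  exact_mod_cast key
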